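/- Let $G$ be a finite simple graph with $v$ vertices and $e$ edges, let $s\ge 2$ be an integer and let $D>9\pi s/4$ be a real number. A trail of length $s$ from $v_0$ to $v_s$ in $G$ is a sequence $(v_0,v_1,\dots,v_s)$ of vertices such that $\{v_0,v_1\},\{v_1,v_2\},\dots,\{v_{s-1},v_s\}$ are pairwise distinct edges of $G$. (i) If $$e>8D^2\,v^{1+1/s},$$ then there are two distinct vertices $v_0$ and $v_s$ of $G$ such that the number of trails of length $s$ from $v_0$ to $v_s$ in $G$ is greater than $D^{2s}/4$. (ii) If $G$ is bipartite with vertex classes of $m$ and $n$ elements and $$e>4D^2\min(m,n)^{1/s}\max(m,n),$$ then the same conclusion holds: there are two distinct vertices $v_0$ and $v_s$ of $G$ such that the number of trails of length $s$ from $v_0$ to $v_s$ in $G$ is greater than $D^{2s}/4$. -/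

import Mathlib

/-- The set of trails of length `s` from `u` to `w` in the graph `G`: walks with `s` edges
(that is, sequences `(v₀, …, v_s)` of vertices, consecutive ones adjacent, with `v₀ = u` and
`v_s = w`) whose edges are pairwise distinct. -/
def trailsOfLength {V : Type*} (G : SimpleGraph V) (s : ℕ) (u w : V) : Set (G.Walk u w) :=
  {p | p.IsTrail ∧ p.length = s}

/-! A set `S` maximizing (edges inside `S`) minus (weight of `S`) has all inner degrees at least the
weights (`exists_induced_degree_ge`). Trails into a fixed `u ∈ S` are then grown backwards: a start
in `S` has at least `b` neighbours in `S`, and fewer than `s + 1` are forbidden, so each step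
multiplies the count by at least `c ≤ b - s` (`mul_pow_le_card_trailsInto`). Pigeonhole over the
starts in `S` finishes (`exists_many_trails`). -/

open Classical in
/-- If vertex weights sum to less than the number of edges, then some induced subgraph contains an
edge and has all its degrees bounded below by the weights. -/
theorem exists_induced_degree_ge {V : Type*} [Fintype V] (G : SimpleGraph V) (W : Finset V)
    (hW : ∀ x y, G.Adj x y → x ∈ W) (f : V → ℝ) (hf : ∀ v, 0 ≤ f v)
    (h : ∑ v ∈ W, f v < (G.edgeSet.ncard : ℝ)) :
    ∃ S ⊆ W, (∃ x ∈ S, ∃ y ∈ S, G.Adj x y) ∧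
      ∀ v ∈ S, f v ≤ ((S.filter (G.Adj v)).card : ℝ) := by
  let E : Finset V → Finset (Sym2 V) := fun S => G.edgeFinset.filter (fun e => ∀ v ∈ e, v ∈ S)
  obtain ⟨S, hS, hmax⟩ := W.powerset.exists_max_image
    (fun S => ((E S).card : ℝ) - ∑ v ∈ S, f v) ⟨W, Finset.mem_powerset_self W⟩
  rw [Finset.mem_powerset] at hS
  have hEW : E W = G.edgeFinset := by
    refine Finset.filter_true_of_mem fun e he v hv => ?_
    obtain ⟨w, rfl⟩ := hv
    exact hW v w (by simpa using he)
  have hpos : 0 < ((E S).card : ℝ) - ∑ v ∈ S, f v := by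
    refine lt_of_lt_of_le ?_ (hmax W (Finset.mem_powerset_self W))
    rw [hEW, ← Set.ncard_coe_finset, SimpleGraph.coe_edgeFinset]
    linarith
  refine ⟨S, hS, ?_, fun v hv => ?_⟩
  · have hsum : 0 ≤ ∑ v ∈ S, f v := Finset.sum_nonneg fun v _ => hf v
    have hcard : 0 < (E S).card := by
      have : (0 : ℝ) < ((E S).card : ℝ) := by linarith
      exact_mod_cast this
    obtain ⟨e, he⟩ := Finset.card_pos.mp hcard
    induction e with
    | h x y =>
      simp only [E, Finset.mem_filter, SimpleGraph.mem_edgeFinset, SimpleGraph.mem_edgeSet,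
        Sym2.mem_iff] at he
      exact ⟨x, he.2 x (Or.inl rfl), y, he.2 y (Or.inr rfl), he.1⟩
  · have h1 := hmax (S.erase v) (Finset.mem_powerset.mpr ((Finset.erase_subset v S).trans hS))
    have h2 : f v + ∑ w ∈ S.erase v, f w = ∑ w ∈ S, f w := Finset.add_sum_erase S f hv
    have hsub : E S ⊆ E (S.erase v) ∪ (S.filter (G.Adj v)).image (fun x => s(v, x)) := by
      intro e he
      simp only [E, Finset.mem_filter, SimpleGraph.mem_edgeFinset] at he
      by_cases hve : v ∈ e
      · obtain ⟨x, rfl⟩ := hve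
        exact Finset.mem_union_right _ (Finset.mem_image.mpr
          ⟨x, Finset.mem_filter.mpr ⟨he.2 x (Sym2.mem_mk_right v x), he.1⟩, rfl⟩)
      · refine Finset.mem_union_left _ ?_
        simp only [E, Finset.mem_filter, SimpleGraph.mem_edgeFinset]
        exact ⟨he.1, fun w hw => Finset.mem_erase.mpr
          ⟨fun hwv => hve (hwv ▸ hw), he.2 w hw⟩⟩
    have h3 : (E S).card ≤ (E (S.erase v)).card + (S.filter (G.Adj v)).card :=
      (Finset.card_le_card hsub).trans ((Finset.card_union_le _ _).trans
        (Nat.add_le_add_left Finset.card_image_le _))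
    have h4 : ((E S).card : ℝ) ≤ (E (S.erase v)).card + (S.filter (G.Adj v)).card := by
      exact_mod_cast h3
    linarith

open Classical in
/-- The trails of length `k` that end in `u` and start in a vertex of `S` other than `u`. -/
noncomputable def trailsInto {V : Type*} [Fintype V] (G : SimpleGraph V) (S : Finset V) (u : V)
    (k : ℕ) : Finset (Σ x, G.Walk x u) :=
  (S.erase u).sigma fun x => (G.finsetWalkLength k x u).filter fun p => p.IsTrail

open Classical in
theorem mem_trailsInto {V : Type*} [Fintype V] {G : SimpleGraph V} {S : Finset V} {u : V}
    {k : ℕ} {p : Σ x, G.Walk x u} :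
    p ∈ trailsInto G S u k ↔ (p.1 ≠ u ∧ p.1 ∈ S) ∧ p.2.length = k ∧ p.2.IsTrail := by
  simp [trailsInto, SimpleGraph.mem_finsetWalkLength_iff]

open Classical in
theorem card_trailsInto {V : Type*} [Fintype V] (G : SimpleGraph V) (S : Finset V) (u : V)
    (k : ℕ) : (trailsInto G S u k).card = ∑ x ∈ S.erase u, (trailsOfLength G k x u).ncard := by
  rw [trailsInto, Finset.card_sigma]
  refine Finset.sum_congr rfl fun x _ => ?_
  rw [← Set.ncard_coe_finset]
  congr 1
  ext p
  simp [trailsOfLength, SimpleGraph.mem_finsetWalkLength_iff, and_comm]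

open Classical in
theorem card_neighbors_le_card_trailsInto_one {V : Type*} [Fintype V] (G : SimpleGraph V)
    (S : Finset V) (u : V) : (S.filter (G.Adj u)).card ≤ (trailsInto G S u 1).card := by
  refine Finset.card_le_card_of_injOn
    (fun x => if h : G.Adj x u then ⟨x, h.toWalk⟩ else ⟨u, SimpleGraph.Walk.nil⟩) ?_ ?_
  · intro x hx
    rw [Finset.mem_coe, Finset.mem_filter] at hx
    simp only [Finset.mem_coe, dif_pos hx.2.symm, mem_trailsInto]
    exact ⟨⟨hx.2.ne', hx.1⟩, by simp [SimpleGraph.Adj.toWalk], by simp [SimpleGraph.Adj.toWalk]⟩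
  · intro x hx y hy hxy
    rw [Finset.mem_coe, Finset.mem_filter] at hx hy
    simp only [dif_pos hx.2.symm, dif_pos hy.2.symm] at hxy
    exact congrArg Sigma.fst hxy

open Classical in
/-- The vertices of `S` other than `u` by which the trail `p` into `u` can be extended at its
start. -/
noncomputable def trailExtensions {V : Type*} (G : SimpleGraph V) (S : Finset V) (u : V)
    (p : Σ x, G.Walk x u) : Finset V :=
  S.filter fun x => x ≠ u ∧ G.Adj p.1 x ∧ s(x, p.1) ∉ p.2.edges

-- Only neighbours along a used edge (at most one per edge of `p`) and `u` itself are lost.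
open Classical in
theorem card_neighbors_le_card_trailExtensions {V : Type*} (G : SimpleGraph V)
    (S : Finset V) (u : V) (p : Σ x, G.Walk x u) :
    (S.filter (G.Adj p.1)).card ≤ (trailExtensions G S u p).card + (p.2.length + 1) := by
  have hsub : S.filter (G.Adj p.1) ⊆ trailExtensions G S u p ∪
      (S.filter (fun x => s(x, p.1) ∈ p.2.edges) ∪ {u}) := by
    intro x hx
    simp only [trailExtensions, Finset.mem_union, Finset.mem_filter, Finset.mem_singleton] at hx ⊢
    tauto
  have hused : (S.filter (fun x => s(x, p.1) ∈ p.2.edges)).card ≤ p.2.length := by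
    rw [← SimpleGraph.Walk.length_edges]
    refine le_trans ?_ p.2.edges.toFinset_card_le
    refine Finset.card_le_card_of_injOn (fun x => s(x, p.1)) ?_ ?_
    · intro x hx
      simpa using (Finset.mem_filter.mp hx).2
    · intro x _ y _ hxy
      exact Sym2.congr_left.mp hxy
  refine (Finset.card_le_card hsub).trans ((Finset.card_union_le _ _).trans ?_)
  refine Nat.add_le_add_left ((Finset.card_union_le _ _).trans ?_) _
  simpa using hused

open Classical in
theorem sum_card_trailExtensions_le {V : Type*} [Fintype V] (G : SimpleGraph V)
    (S : Finset V) (u : V) (k : ℕ) :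
    ∑ p ∈ trailsInto G S u k, (trailExtensions G S u p).card
      ≤ (trailsInto G S u (k + 1)).card := by
  rw [← Finset.card_sigma]
  refine Finset.card_le_card_of_injOn
    -- The `nil` branch is junk, never reached on the domain.
    (fun q => if h : G.Adj q.2 q.1.1 then ⟨q.2, SimpleGraph.Walk.cons h q.1.2⟩
      else ⟨u, SimpleGraph.Walk.nil⟩) ?_ ?_
  · rintro ⟨p, x⟩ hq
    simp only [trailExtensions, Finset.coe_sigma, Set.mem_sigma_iff, Finset.mem_coe,
      Finset.mem_filter, mem_trailsInto] at hq
    obtain ⟨⟨-, hlen, htrail⟩, hxS, hxu, hadj, hedge⟩ := hq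
    simp only [Finset.mem_coe, dif_pos hadj.symm, mem_trailsInto]
    exact ⟨⟨hxu, hxS⟩, by simp [hlen], by simp [SimpleGraph.Walk.isTrail_cons, htrail, hedge]⟩
  · rintro ⟨⟨y, p⟩, x⟩ hq ⟨⟨y', p'⟩, x'⟩ hq' heq
    simp only [trailExtensions, Finset.coe_sigma, Set.mem_sigma_iff, Finset.mem_coe,
      Finset.mem_filter, mem_trailsInto] at hq hq'
    simp only [dif_pos hq.2.2.2.1.symm, dif_pos hq'.2.2.2.1.symm] at heq
    obtain rfl : x = x' := congrArg Sigma.fst heq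
    have h2 := eq_of_heq (Sigma.mk.inj heq).2
    obtain ⟨rfl, h3⟩ := SimpleGraph.Walk.cons.inj h2
    rw [eq_of_heq h3]

open Classical in
theorem mul_pow_le_card_trailsInto {V : Type*} [Fintype V] (G : SimpleGraph V)
    (S : Finset V) (u : V) (s : ℕ) (a b c : ℝ) (hc : 0 ≤ c) (hcb : c + s ≤ b)
    (hu : a ≤ ((S.filter (G.Adj u)).card : ℝ))
    (hS : ∀ v ∈ S, b ≤ ((S.filter (G.Adj v)).card : ℝ)) (k : ℕ) (hk : k + 1 ≤ s) :
    a * c ^ k ≤ ((trailsInto G S u (k + 1)).card : ℝ) := by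
  induction k with
  | zero =>
    rw [pow_zero, mul_one]
    exact hu.trans (by exact_mod_cast card_neighbors_le_card_trailsInto_one G S u)
  | succ k ih =>
    have hext : ∀ p ∈ trailsInto G S u (k + 1), c ≤ ((trailExtensions G S u p).card : ℝ) := by
      intro p hp
      rw [mem_trailsInto] at hp
      have h1 : ((S.filter (G.Adj p.1)).card : ℝ) ≤
          (trailExtensions G S u p).card + ((p.2.length + 1 : ℕ) : ℝ) := by
        exact_mod_cast card_neighbors_le_card_trailExtensions G S u p
      have h2 : ((p.2.length + 1 : ℕ) : ℝ) ≤ s := by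
        rw [hp.2.1]
        exact_mod_cast hk
      linarith [hS p.1 hp.1.2]
    calc a * c ^ (k + 1) = a * c ^ k * c := by ring
      _ ≤ (trailsInto G S u (k + 1)).card * c :=
        mul_le_mul_of_nonneg_right (ih (by omega)) hc
      _ = ∑ p ∈ trailsInto G S u (k + 1), c := by simp
      _ ≤ ∑ p ∈ trailsInto G S u (k + 1), ((trailExtensions G S u p).card : ℝ) :=
        Finset.sum_le_sum hext
      _ ≤ (trailsInto G S u (k + 1 + 1)).card := by
        exact_mod_cast sum_card_trailExtensions_le G S u (k + 1)

open Classical in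
/-- Greedy extension and pigeonhole: in an induced subgraph of large minimum degree some vertex
other than `u` starts many trails of length `s` into `u`. -/
theorem exists_many_trails {V : Type*} [Fintype V] (G : SimpleGraph V)
    (S : Finset V) (u : V) (s : ℕ) (hs : 1 ≤ s) (a b c N L : ℝ) (hc : 0 ≤ c) (hcb : c + s ≤ b)
    (hu : a ≤ ((S.filter (G.Adj u)).card : ℝ))
    (hS : ∀ v ∈ S, b ≤ ((S.filter (G.Adj v)).card : ℝ))
    (hN : (S.card : ℝ) ≤ N) (hL : 0 ≤ L) (hlt : N * L < a * c ^ (s - 1)) :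
    ∃ v w : V, v ≠ w ∧ L < ((trailsOfLength G s v w).ncard : ℝ) := by
  by_contra! hcon
  have h1 := mul_pow_le_card_trailsInto G S u s a b c hc hcb hu hS (s - 1) (by omega)
  rw [Nat.sub_add_cancel hs, card_trailsInto] at h1
  have h2 : ((∑ x ∈ S.erase u, (trailsOfLength G s x u).ncard : ℕ) : ℝ) ≤ N * L := by
    push_cast
    calc ∑ x ∈ S.erase u, ((trailsOfLength G s x u).ncard : ℝ)
        ≤ ∑ x ∈ S.erase u, L :=
          Finset.sum_le_sum fun x hx => hcon x u (Finset.ne_of_mem_erase hx)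
      _ = (S.erase u).card * L := by simp
      _ ≤ N * L := by
        refine mul_le_mul_of_nonneg_right (le_trans ?_ hN) hL
        exact_mod_cast Finset.card_erase_le
  linarith

theorem exists_many_trails_of_card_edges {V : Type*} [Fintype V] (G : SimpleGraph V) (s : ℕ)
    (hs : 1 ≤ s) (D : ℝ) (hD1 : 1 ≤ D) (hDs : (s : ℝ) ≤ D)
    (h : 8 * D ^ 2 * (Fintype.card V : ℝ) ^ (1 + 1 / (s : ℝ)) < (G.edgeSet.ncard : ℝ)) :
    ∃ v w : V, v ≠ w ∧ D ^ (2 * s) / 4 < ((trailsOfLength G s v w).ncard : ℝ) := by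
  classical
  have hne : Nonempty V := by
    by_contra hV
    rw [not_nonempty_iff] at hV
    have h0 : G.edgeSet = ∅ := by
      ext e
      induction e with
      | h x y => exact isEmptyElim x
    rw [h0, Set.ncard_empty, Nat.cast_zero] at h
    exact absurd h (not_lt.mpr (by positivity))
  have hv : (1 : ℝ) ≤ Fintype.card V := by exact_mod_cast Fintype.card_pos
  set t : ℝ := (Fintype.card V : ℝ) ^ (1 / (s : ℝ)) with ht
  have ht1 : 1 ≤ t := Real.one_le_rpow hv (by positivity)
  have hts : t ^ s = Fintype.card V := by
    rw [ht, one_div]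
    exact Real.rpow_inv_natCast_pow (by positivity) (by omega)
  rw [Real.rpow_add (by linarith), Real.rpow_one, ← ht] at h
  obtain ⟨S, -, ⟨u, huS, -⟩, hS⟩ := exists_induced_degree_ge G Finset.univ
    (fun x _ _ => Finset.mem_univ x) (fun _ => 8 * D ^ 2 * t) (fun _ => by positivity)
    (by
      rw [Finset.sum_const, nsmul_eq_mul, Finset.card_univ]
      linarith)
  -- Gives `c + s ≤ b` with `c = D ^ 2 * t`.
  have hsD : (s : ℝ) ≤ D ^ 2 * t := by nlinarith
  refine exists_many_trails G S u s hs (8 * D ^ 2 * t) (8 * D ^ 2 * t) (D ^ 2 * t)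
    (Fintype.card V) _ (by positivity) (by linarith) (hS u huS) hS
    (by exact_mod_cast Finset.card_le_univ S) (by positivity) ?_
  have hpow : D ^ 2 * t * (D ^ 2 * t) ^ (s - 1) = D ^ (2 * s) * Fintype.card V := by
    rw [mul_pow_sub_one (by omega), mul_pow, hts, ← pow_mul]
  have hpos : 0 < D ^ (2 * s) * (Fintype.card V : ℝ) := by positivity
  calc (Fintype.card V : ℝ) * (D ^ (2 * s) / 4) < 8 * (D ^ (2 * s) * Fintype.card V) := by linarith
    _ = 8 * D ^ 2 * t * (D ^ 2 * t) ^ (s - 1) := by rw [← hpow]; ring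

theorem exists_many_trails_of_isBipartiteWith {V : Type*} [Fintype V] (G : SimpleGraph V) (s : ℕ)
    (hs : 1 ≤ s) (D : ℝ) (hD1 : 1 ≤ D) (hDs : (s : ℝ) ≤ D) (X Y : Finset V)
    (hG : G.IsBipartiteWith (X : Set V) (Y : Set V)) (hXY : X.card ≤ Y.card)
    (h : 4 * D ^ 2 * (X.card : ℝ) ^ (1 / (s : ℝ)) * (Y.card : ℝ) < (G.edgeSet.ncard : ℝ)) :
    ∃ v w : V, v ≠ w ∧ D ^ (2 * s) / 4 < ((trailsOfLength G s v w).ncard : ℝ) := by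
  classical
  have hdisj : Disjoint X Y := by exact_mod_cast hG.disjoint
  have hXpos : 0 < X.card := by
    rw [Finset.card_pos]
    by_contra hX
    rw [Finset.not_nonempty_iff_eq_empty] at hX
    have h0 : G.edgeSet = ∅ := by
      ext e
      induction e with
      | h x y =>
        refine iff_of_false (fun hxy => ?_) (Set.notMem_empty _)
        have := hG.mem_of_adj hxy
        simp [hX] at this
    rw [h0, Set.ncard_empty, Nat.cast_zero] at h
    exact absurd h (not_lt.mpr (by positivity))
  have hm : (1 : ℝ) ≤ X.card := by exact_mod_cast hXpos
  have hmn : (X.card : ℝ) ≤ Y.card := by exact_mod_cast hXY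
  set m : ℝ := (X.card : ℝ) with hm_def
  set n : ℝ := (Y.card : ℝ) with hn_def
  set t : ℝ := m ^ (1 / (s : ℝ)) with ht
  have hm0 : 0 < m := by linarith
  have hn0 : 0 < n := by linarith
  have ht1 : 1 ≤ t := Real.one_le_rpow hm (by positivity)
  have hts : t ^ s = m := by
    rw [ht, one_div]
    exact Real.rpow_inv_natCast_pow (by positivity) (by omega)
  have hb : 0 ≤ 2 * D ^ 2 * t := by positivity
  have hab : 2 * D ^ 2 * t ≤ 2 * D ^ 2 * t * (n / m) :=
    le_mul_of_one_le_right hb ((one_le_div hm0).mpr hmn)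
  obtain ⟨S, hSW, ⟨x, hx, y, hy, hxy⟩, hS⟩ := exists_induced_degree_ge G (X ∪ Y)
    (fun x y hxy => by
      rcases hG.mem_of_adj hxy with hxy | hxy
      · exact Finset.mem_union_left _ hxy.1
      · exact Finset.mem_union_right _ hxy.1)
    -- Each class gets total weight `2 * D ^ 2 * t * n`, half of the edge bound.
    (fun v => if v ∈ X then 2 * D ^ 2 * t * (n / m) else 2 * D ^ 2 * t)
    (fun v => by split_ifs <;> positivity)
    (by
      have hY : ∀ v ∈ Y, v ∉ X := fun v hv hvX => Finset.disjoint_left.mp hdisj hvX hv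
      rw [Finset.sum_union hdisj, Finset.sum_congr rfl fun v hv => if_pos hv,
        Finset.sum_congr rfl fun v hv => if_neg (hY v hv), Finset.sum_const, Finset.sum_const,
        nsmul_eq_mul, nsmul_eq_mul, ← hm_def, ← hn_def]
      have : m * (2 * D ^ 2 * t * (n / m)) = 2 * D ^ 2 * t * n := by field_simp
      linarith)
  -- With `u` in the smaller class, the first step gains the factor `n / m`, which offsets the up to
  -- `m + n ≤ 2 * n` starts in the pigeonhole.
  obtain ⟨u, huS, huX⟩ : ∃ u ∈ S, u ∈ X := by
    rcases hG.mem_of_adj hxy with hxy | hxy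
    · exact ⟨x, hx, hxy.1⟩
    · exact ⟨y, hy, hxy.2⟩
  have hsD : (s : ℝ) ≤ D ^ 2 * t := by nlinarith
  have hN : (S.card : ℝ) ≤ m + n := by
    rw [hm_def, hn_def]
    exact_mod_cast (Finset.card_le_card hSW).trans (Finset.card_union_le X Y)
  refine exists_many_trails G S u s hs (2 * D ^ 2 * t * (n / m)) (2 * D ^ 2 * t) (D ^ 2 * t)
    (m + n) _ (by positivity) (by linarith) ?_ ?_ hN (by positivity) ?_
  · simpa only [if_pos huX] using hS u huS
  · intro v hv
    refine le_trans ?_ (hS v hv)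
    split_ifs
    · exact hab
    · exact le_rfl
  have hpow : D ^ 2 * t * (D ^ 2 * t) ^ (s - 1) = D ^ (2 * s) * m := by
    rw [mul_pow_sub_one (by omega), mul_pow, hts, ← pow_mul]
  have hpos : 0 < D ^ (2 * s) := by positivity
  calc (m + n) * (D ^ (2 * s) / 4) < 2 * (D ^ (2 * s) * n) := by nlinarith
    _ = 2 * (n / m) * (D ^ (2 * s) * m) := by field_simp
    _ = 2 * D ^ 2 * t * (n / m) * (D ^ 2 * t) ^ (s - 1) := by rw [← hpow]; ring

theorem mainTheorem5 {V : Type*} [Fintype V] (G : SimpleGraph V) (s : ℕ) (hs : 2 ≤ s)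
    (D : ℝ) (hD : 9 * Real.pi * (s : ℝ) / 4 < D) :
    (8 * D ^ 2 * (Fintype.card V : ℝ) ^ (1 + 1 / (s : ℝ)) < (G.edgeSet.ncard : ℝ) →
      ∃ v w : V, v ≠ w ∧
        D ^ (2 * s) / 4 < ((trailsOfLength G s v w).ncard : ℝ)) ∧
    (∀ X Y : Finset V, G.IsBipartiteWith (X : Set V) (Y : Set V) →
      4 * D ^ 2 * (min X.card Y.card : ℝ) ^ (1 / (s : ℝ)) * (max X.card Y.card : ℝ)
          < (G.edgeSet.ncard : ℝ) →
      ∃ v w : V, v ≠ w ∧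
        D ^ (2 * s) / 4 < ((trailsOfLength G s v w).ncard : ℝ)) := by
  have hs' : (2 : ℝ) ≤ s := by exact_mod_cast hs
  -- The constant `9π/4` matters only through exceeding 1.
  have hDs : (s : ℝ) ≤ D := by nlinarith [Real.pi_gt_three]
  have hD1 : 1 ≤ D := by linarith
  refine ⟨exists_many_trails_of_card_edges G s (by omega) D hD1 hDs, fun X Y hG h => ?_⟩
  rcases le_total X.card Y.card with hXY | hXY
  · have hXY' : (X.card : ℝ) ≤ Y.card := by exact_mod_cast hXY
    rw [min_eq_left hXY', max_eq_right hXY'] at h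
    exact exists_many_trails_of_isBipartiteWith G s (by omega) D hD1 hDs X Y hG hXY h
  · have hXY' : (Y.card : ℝ) ≤ X.card := by exact_mod_cast hXY
    rw [min_eq_right hXY', max_eq_left hXY'] at h
    exact exists_many_trails_of_isBipartiteWith G s (by omega) D hD1 hDs Y X hG.symm hXY h
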